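/- Let $(X,J)$ be a compact connected complex manifold of complex dimension $n$ and let $\omega$ be a Kähler form on $X$ (a smooth closed real $J$-invariant $2$-form with $\omega(\cdot,J\cdot)>0$). Put $V=\int_X\frac{\omega^n}{n!}$ and $\mathrm{Ric}(\omega)=-\sqrt{-1}\,\partial\bar\partial\log\omega^n$. Assume that $\omega$ has a Ricci potential, i.e. there is $\phi\in C^\infty(X,\mathbb R)$ with $$\mathrm{Ric}(\omega)-\omega=\sqrt{-1}\,\partial\bar\partial\phi,\qquad \frac1V\int_X(e^{\phi}-1)\frac{\omega^n}{n!}=0$$ (so that $X$ is a Fano manifold and $\omega$ represents $2\pi c_1(X)$). Let $\mathfrak{aut}(X,\omega,J)$ be the Lie algebra of smooth real vector fields $\zeta$ with $L_\zeta J=0$ and $L_\zeta\omega=0$. A Hamiltonian of $\zeta$ is a function $\theta\in C^\infty(X,\mathbb R)$ with $d\theta=\omega(\zeta,\cdot)$. For $\xi,\eta\in\mathfrak{aut}(X,\omega,J)$ let $\theta_\eta,\widetilde\theta_\eta$ be Hamiltonians of $\eta$ and $\hat\theta_\xi,\widetilde\theta_\xi$ Hamiltonians of $\xi$, normalized by $$\int_X\theta_\eta\frac{\omega^n}{n!}=0,\qquad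 \int_X\big(e^{\hat\theta_\xi}-1\big)\frac{\omega^n}{n!}=0,\qquad \int_X\widetilde\theta_\eta\,e^{\phi}\frac{\omega^n}{n!}=\int_X\widetilde\theta_\xi\,e^{\phi}\frac{\omega^n}{n!}=0 .$$ Set $$\mu(J):=\frac1V(e^{\phi}-1)\frac{\omega^n}{n!},\qquad d\widehat{\mathbf D_F}(u):=\frac1V(e^{u}-1)\frac{\omega^n}{n!}\quad (u\in C^\infty(X,\mathbb R)),$$ and let $\langle h\frac{\omega^n}{n!},\theta\rangle=\int_X h\,\theta\,\frac{\omega^n}{n!}$. Then the Tian–Zhu generalized Futaki invariant is given by $$\frac{\int_X\widetilde\theta_\eta\,e^{\widetilde\theta_\xi}\,\omega^n}{\int_X e^{\widetilde\theta_\xi}\,\omega^n}=\Big\langle d\widehat{\mathbf D_F}(\hat\theta_\xi)-\mu(J),\ \theta_\eta\Big\rangle .$$ Moreover, there is a constant $\hat C\in\mathbb R$ with $\widetilde\theta_\xi=\hat\theta_\xi+\hat C$ and $e^{\hat C}=\int_X e^{\widetilde\theta_\xi}\omega^n\big/\int_X e^{\hat\theta_\xi}\omega^n$, and $$\frac1V\int_X\widetilde\theta_\eta\,e^{\widetilde\theta_\xi}\,\frac{\omega^n}{n!}=e^{\hat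 C}\,\Big\langle d\widehat{\mathbf D_F}(\hat\theta_\xi)-\mu(J),\ \theta_\eta\Big\rangle .$$ -/

import Mathlib

open Set MeasureTheory
open scoped Manifold ContDiff Topology

/-- The model space `ℂⁿ` of an `n`-dimensional complex manifold, with its standard Lebesgue measure. -/
abbrev CSpace (n : ℕ) : Type := Fin n → ℂ

/-- The real tangent space at `x` of a manifold modelled on `ℂⁿ`. -/
abbrev RealTangent (n : ℕ) {M : Type*} [TopologicalSpace M] [ChartedSpace (CSpace n) M]
    (x : M) : Type :=
  TangentSpace 𝓘(ℝ, CSpace n) x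

/-- The complex structure `J` of a complex manifold: multiplication by `i` in the trivialization
of the tangent space by a holomorphic chart (the result does not depend on the chart, because the
transition maps have complex linear derivatives). -/
def complexStructure {n : ℕ} {M : Type*} [TopologicalSpace M] [ChartedSpace (CSpace n) M]
    {x : M} (v : RealTangent n x) : RealTangent n x :=
  (Complex.I • (show CSpace n from v) : CSpace n)

/-- A field of real bilinear forms on the tangent spaces, read in a chart `e`: the value at
`y ∈ e.target` of the pull-back by `e⁻¹` on two vectors of `ℂⁿ`. -/
noncomputable def localForm {n : ℕ} {M : Type*} [TopologicalSpace M] [ChartedSpace (CSpace n) M]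
    (B : ∀ x : M, RealTangent n x →L[ℝ] RealTangent n x →L[ℝ] ℝ)
    (e : OpenPartialHomeomorph M (CSpace n)) (y u v : CSpace n) : ℝ :=
  B (e.symm y) (mfderiv 𝓘(ℝ, CSpace n) 𝓘(ℝ, CSpace n) e.symm y u)
    (mfderiv 𝓘(ℝ, CSpace n) 𝓘(ℝ, CSpace n) e.symm y v)

/-- A vector field read in a chart `e`: the push-forward by `e`, as a map `ℂⁿ → ℂⁿ`
(meaningful on `e.target`). -/
noncomputable def localField {n : ℕ} {M : Type*} [TopologicalSpace M] [ChartedSpace (CSpace n) M]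
    (ξ : ∀ x : M, RealTangent n x) (e : OpenPartialHomeomorph M (CSpace n)) (y : CSpace n) :
    CSpace n :=
  mfderiv 𝓘(ℝ, CSpace n) 𝓘(ℝ, CSpace n) e (e.symm y) (ξ (e.symm y))

/-- The real `(1,1)`-form `√-1 ∂∂̄ f = -½ d(df ∘ J)` of a real function `f` on an open part of `ℂⁿ`,
at `y`, on the vectors `u`, `v`. In one variable `√-1 ∂∂̄ |z|² = 2 dx ∧ dy`. -/
noncomputable def iddbar {n : ℕ} (f : CSpace n → ℝ) (y u v : CSpace n) : ℝ :=
  -(1 / 2) * (fderiv ℝ (fun z => fderiv ℝ f z (Complex.I • v)) y u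
    - fderiv ℝ (fun z => fderiv ℝ f z (Complex.I • u)) y v)

/-- The `n`-fold wedge power of an alternating bilinear form `B`, evaluated on `2n` vectors
`v (0,0), v (0,1), v (1,0), v (1,1), …`:
`Bⁿ(v) = 2⁻ⁿ ∑_σ sgn σ ∏ᵢ B(v(σ(i,0)), v(σ(i,1)))`. -/
noncomputable def wedgePower {V : Type*} (n : ℕ) (B : V → V → ℝ) (v : Fin n × Fin 2 → V) : ℝ :=
  (1 / 2 ^ n) * ∑ σ : Equiv.Perm (Fin n × Fin 2),
    ((Equiv.Perm.sign σ : ℤ) : ℝ) * ∏ i : Fin n, B (v (σ (i, 0))) (v (σ (i, 1)))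

/-- The positively oriented real frame `∂/∂x₁, ∂/∂y₁, …, ∂/∂xₙ, ∂/∂yₙ` of `ℂⁿ`. -/
noncomputable def realFrame (n : ℕ) (p : Fin n × Fin 2) : CSpace n :=
  Pi.single p.1 (if p.2 = 0 then 1 else Complex.I)

/-- A Kähler form on a complex manifold: a smooth closed real `2`-form `ω` that is `J`-invariant and
satisfies `ω(·, J·) > 0`. -/
structure KahlerForm (n : ℕ) (M : Type*) [TopologicalSpace M] [ChartedSpace (CSpace n) M] where
  /-- the underlying field of bilinear forms -/
  form : ∀ x : M, RealTangent n x →L[ℝ] RealTangent n x →L[ℝ] ℝ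
  alternating : ∀ (x : M) (v : RealTangent n x), form x v v = 0
  smooth : ∀ e ∈ atlas (CSpace n) M, ∀ u v : CSpace n,
    ContDiffOn ℝ ∞ (fun y => localForm form e y u v) e.target
  closed : ∀ e ∈ atlas (CSpace n) M, ∀ y ∈ e.target, ∀ u v w : CSpace n,
    fderiv ℝ (fun z => localForm form e z v w) y u
      + fderiv ℝ (fun z => localForm form e z w u) y v
      + fderiv ℝ (fun z => localForm form e z u v) y w = 0
  invariant : ∀ (x : M) (v w : RealTangent n x),
    form x (complexStructure v) (complexStructure w) = form x v w
  positive : ∀ (x : M) (v : RealTangent n x), v ≠ 0 → 0 < form x v (complexStructure v)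

/-- On a compact Hausdorff manifold there is a partition of unity subordinate to the family of
preferred chart domains. -/
theorem exists_chartPartition (n : ℕ) (M : Type*) [TopologicalSpace M] [T2Space M] [CompactSpace M]
    [ChartedSpace (CSpace n) M] :
    ∃ ρ : PartitionOfUnity M M univ,
      ρ.IsSubordinate (fun x => (chartAt (CSpace n) x).source) :=
  PartitionOfUnity.exists_isSubordinate isClosed_univ _
    (fun x => (chartAt (CSpace n) x).open_source)
    (fun x _ => mem_iUnion.2 ⟨x, mem_chart_source _ x⟩)

/-- A partition of unity subordinate to the chart domains. -/
noncomputable def chartPartition (n : ℕ) (M : Type*) [TopologicalSpace M] [T2Space M]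
    [CompactSpace M] [ChartedSpace (CSpace n) M] : PartitionOfUnity M M univ :=
  (exists_chartPartition n M).choose

namespace KahlerForm

section Local

variable {n : ℕ} {M : Type*} [TopologicalSpace M] [ChartedSpace (CSpace n) M]

/-- The coefficient of the top degree form `ωⁿ` in a holomorphic chart `e`:
`ωⁿ = (powDensity e) dx₁ ∧ dy₁ ∧ … ∧ dxₙ ∧ dyₙ`. -/
noncomputable def powDensity (ωX : KahlerForm n M) (e : OpenPartialHomeomorph M (CSpace n))
    (y : CSpace n) : ℝ :=
  wedgePower n (localForm ωX.form e y) (realFrame n)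

/-- The Ricci form `Ric(ω) = -√-1 ∂∂̄ log ωⁿ`, read in a holomorphic chart `e`. -/
noncomputable def localRicci (ωX : KahlerForm n M) (e : OpenPartialHomeomorph M (CSpace n))
    (y u v : CSpace n) : ℝ :=
  -iddbar (fun z => Real.log (ωX.powDensity e z)) y u v

/-- `φ` is a Ricci potential of `ω`: a smooth real function with `Ric(ω) - ω = √-1 ∂∂̄ φ`.
(If one exists, then `ω ∈ 2π c₁(X)`, so a compact `X` is a Fano manifold polarized by `ω`.) -/
structure IsRicciPotential (ωX : KahlerForm n M) (φ : M → ℝ) : Prop where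
  smooth : ContMDiff 𝓘(ℝ, CSpace n) 𝓘(ℝ, ℝ) ∞ φ
  ricci : ∀ e ∈ atlas (CSpace n) M, ∀ y ∈ e.target, ∀ u v : CSpace n,
    ωX.localRicci e y u v - localForm ωX.form e y u v = iddbar (φ ∘ e.symm) y u v

/-- The Lie algebra `𝔞𝔲𝔱(X, ω, J)`, as a set: the smooth real vector fields `ξ` with `L_ξ J = 0`
and `L_ξ ω = 0`, both written out in the charts of the atlas. -/
structure IsAut (ωX : KahlerForm n M) (ξ : ∀ x : M, RealTangent n x) : Prop where
  smooth : ∀ e ∈ atlas (CSpace n) M, ContDiffOn ℝ ∞ (localField ξ e) e.target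
  lie_complexStructure : ∀ e ∈ atlas (CSpace n) M, ∀ y ∈ e.target, ∀ u : CSpace n,
    fderiv ℝ (localField ξ e) y (Complex.I • u) = Complex.I • fderiv ℝ (localField ξ e) y u
  lie_form : ∀ e ∈ atlas (CSpace n) M, ∀ y ∈ e.target, ∀ u v : CSpace n,
    fderiv ℝ (fun z => localForm ωX.form e z u v) y (localField ξ e y)
      + localForm ωX.form e y (fderiv ℝ (localField ξ e) y u) v
      + localForm ωX.form e y u (fderiv ℝ (localField ξ e) y v) = 0

/-- `θ` is a Hamiltonian (potential) of the vector field `ξ`: a smooth real function with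
`dθ = ω(ξ, ·)`. -/
structure IsHamiltonian (ωX : KahlerForm n M) (ξ : ∀ x : M, RealTangent n x) (θ : M → ℝ) :
    Prop where
  smooth : ContMDiff 𝓘(ℝ, CSpace n) 𝓘(ℝ, ℝ) ∞ θ
  d_eq : ∀ (x : M) (v : RealTangent n x),
    mfderiv 𝓘(ℝ, CSpace n) 𝓘(ℝ, ℝ) θ x v = ωX.form x (ξ x) v

end Local

section Integral

variable {n : ℕ} {M : Type*} [TopologicalSpace M] [T2Space M] [CompactSpace M]
  [ChartedSpace (CSpace n) M] [MeasurableSpace M]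

/-- The measure on `X` given by the volume form `ωⁿ`, by the usual integration of top degree forms:
with a partition of unity `ρ` subordinate to charts, it is the sum over the charts `e` of the images
under `e⁻¹` of the measures `(ρ ∘ e⁻¹) · (coefficient of ωⁿ in e) dx₁ dy₁ … dxₙ dyₙ`. -/
noncomputable def powMeasure (ωX : KahlerForm n M) : Measure M :=
  Measure.sum fun x : M =>
    Measure.map (chartAt (CSpace n) x).symm
      ((volume.restrict (chartAt (CSpace n) x).target).withDensity fun y =>
        ENNReal.ofReal (chartPartition n M x ((chartAt (CSpace n) x).symm y)
          * ωX.powDensity (chartAt (CSpace n) x) y))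

/-- `∫_X f ωⁿ`. -/
noncomputable def intPow (ωX : KahlerForm n M) (f : M → ℝ) : ℝ :=
  ∫ x, f x ∂ωX.powMeasure

/-- `∫_X f ωⁿ / n!`. -/
noncomputable def intVol (ωX : KahlerForm n M) (f : M → ℝ) : ℝ :=
  ωX.intPow f / (n.factorial : ℝ)

/-- The volume `V = ∫_X ωⁿ / n!`. -/
noncomputable def vol (ωX : KahlerForm n M) : ℝ :=
  ωX.intVol fun _ => 1

/-- The pairing `⟨h ωⁿ/n!, θ⟩ = ∫_X h θ ωⁿ/n!` of top degree forms with functions. An element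
`h ωⁿ/n!` of the dual of the Lie algebra of Hamiltonian functions is given by its density `h`. -/
noncomputable def pairing (ωX : KahlerForm n M) (h θ : M → ℝ) : ℝ :=
  ωX.intVol fun x => h x * θ x

/-- The density with respect to `ωⁿ/n!` of `μ(J) = (1/V) (e^φ - 1) ωⁿ/n!`,
where `φ` is the normalized Ricci potential. -/
noncomputable def momentMap (ωX : KahlerForm n M) (φ : M → ℝ) : M → ℝ :=
  fun x => (1 / ωX.vol) * (Real.exp (φ x) - 1)

/-- The density with respect to `ωⁿ/n!` of `d𝐃̂_F(u) = (1/V) (e^u - 1) ωⁿ/n!`. -/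
noncomputable def dDHat (ωX : KahlerForm n M) (u : M → ℝ) : M → ℝ :=
  fun x => (1 / ωX.vol) * (Real.exp (u x) - 1)

end Integral

end KahlerForm

/-! ### Linear algebra: sign of the top wedge power. -/

section LinearAlgebra

variable {V : Type*} [AddCommGroup V]

/-! On a connected manifold, Hamiltonians of one field differ by constants: θ̃_η = θ_η + c and θ̃_ξ
= θ̂_ξ + C. The factor e^C cancels in the Tian–Zhu quotient, so θ̂_ξ may replace θ̃_ξ. By their
normalizations e^θ̂_ξ and e^φ both have mass W = ∫ωⁿ. Hence ∫θ̃_η e^φ = 0 says ∫θ_η e^φ = -cW, so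
∫θ_η(e^θ̂_ξ - e^φ) = ∫θ_η e^θ̂_ξ + cW = ∫θ̃_η e^θ̂_ξ. Dividing by W gives the pairing.

This needs the measure ωⁿ to be finite and nonzero. Finiteness (`isFiniteMeasure_powMeasure`) comes
from compactness. Nonvanishing (`powMeasure_univ_ne_zero`) needs the coefficient of ωⁿ to be
positive in holomorphic charts (`powDensity_pos`), because `powMeasure` truncates negative densities
to zero. That positivity is `wedgePower_realFrame_pos`: compare the standard frame with a unitary
one by a complex linear map, whose real determinant is positive. -/

theorem prod_update_pair {V : Type*} {n : ℕ} [DecidableEq (Fin n × Fin 2)] (B : V → V → ℝ)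
    (v : Fin n × Fin 2 → V) (j : Fin n) (k : Fin 2) (z : V) :
    ∏ i, B (Function.update v (j, k) z (i, 0)) (Function.update v (j, k) z (i, 1))
      = B (Function.update v (j, k) z (j, 0)) (Function.update v (j, k) z (j, 1))
        * ∏ i ∈ {j}ᶜ, B (v (i, 0)) (v (i, 1)) := by
  rw [Fintype.prod_eq_mul_prod_compl j]
  congr 1
  refine Finset.prod_congr rfl fun i hi => ?_
  have h : ∀ l, (i, l) ≠ (j, k) := by
    rintro l h
    simp_all
  rw [Function.update_of_ne (h 0), Function.update_of_ne (h 1)]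

/-- The product of the values of a bilinear form on the pairs of a family of `2n` vectors, as a
multilinear map. -/
noncomputable def pairProd [Module ℝ V] (n : ℕ) (B : V →ₗ[ℝ] V →ₗ[ℝ] ℝ) :
    MultilinearMap ℝ (fun _ : Fin n × Fin 2 => V) ℝ where
  toFun v := ∏ i, B (v (i, 0)) (v (i, 1))
  map_update_add' := by
    rintro _ v ⟨j, k⟩ x y
    simp only [prod_update_pair (fun u w => B u w), ← add_mul]
    congr 1
    fin_cases k <;> simp
  map_update_smul' := by
    rintro _ v ⟨j, k⟩ c x
    simp only [prod_update_pair (fun u w => B u w), smul_eq_mul, ← mul_assoc]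
    congr 1
    fin_cases k <;> simp

theorem wedgePower_eq_alternatization [Module ℝ V] (n : ℕ) (B : V →ₗ[ℝ] V →ₗ[ℝ] ℝ)
    (v : Fin n × Fin 2 → V) :
    wedgePower n (fun u w => B u w) v
      = (1 / 2 ^ n) * MultilinearMap.alternatization (pairProd n B) v := by
  simp [wedgePower, MultilinearMap.alternatization_apply, pairProd, Units.smul_def]

/-- An alternating map of top degree scales by the determinant. -/
theorem AlternatingMap.map_comp_basis {ι : Type*} [Fintype ι] [DecidableEq ι] [Module ℝ V]
    (f : V [⋀^ι]→ₗ[ℝ] ℝ) (e : Module.Basis ι ℝ V) (g : V →ₗ[ℝ] V) :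
    f (g ∘ e) = LinearMap.det g * f e := by
  have h := congrArg (fun F : V [⋀^ι]→ₗ[ℝ] ℝ => F (g ∘ e)) (f.eq_smul_basis_det e)
  simp only [AlternatingMap.smul_apply, Module.Basis.det_comp, Module.Basis.det_self, smul_eq_mul,
    mul_one] at h
  rw [h, mul_comm]

/-- In a symplectic frame every term of the wedge power is nonnegative. -/
theorem wedgePower_pos_of_symplectic {V : Type*} (n : ℕ) (B : V → V → ℝ) (f : Fin n × Fin 2 → V)
    (h00 : ∀ i j, B (f (i, 0)) (f (j, 0)) = 0) (h11 : ∀ i j, B (f (i, 1)) (f (j, 1)) = 0)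
    (h01 : ∀ i j, B (f (i, 0)) (f (j, 1)) = if i = j then 1 else 0)
    (h10 : ∀ i j, B (f (i, 1)) (f (j, 0)) = if i = j then -1 else 0) :
    0 < wedgePower n B f := by
  -- The identity permutation contributes exactly 1.
  refine mul_pos (by positivity) (Finset.sum_pos' (fun σ _ => ?_)
    ⟨1, Finset.mem_univ _, by simp [h01]⟩)
  by_cases h0 : ∏ i, B (f (σ (i, 0))) (f (σ (i, 1))) = 0
  · simp [h0]
  have hne : ∀ i, B (f (σ (i, 0))) (f (σ (i, 1))) ≠ 0 := fun i =>
    Finset.prod_ne_zero_iff.1 h0 i (Finset.mem_univ i)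
  have key : ∀ p q : Fin n × Fin 2, B (f p) (f q) ≠ 0 →
      p.1 = q.1 ∧ p.2 ≠ q.2 ∧ B (f p) (f q) = if p.2 = 0 then 1 else -1 := by
    rintro ⟨i, k⟩ ⟨j, l⟩ h
    fin_cases k <;> fin_cases l <;> simp_all
  have hfst : ∀ i, (σ (i, 0)).1 = (σ (i, 1)).1 := fun i => (key _ _ (hne i)).1
  have hsnd : ∀ i, (σ (i, 0)).2 ≠ (σ (i, 1)).2 := fun i => (key _ _ (hne i)).2.1
  have hval := fun i => (key _ _ (hne i)).2.2
  -- In a nonzero term σ keeps each symplectic pair together. The images of one pair fill the fibre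
  -- over their common index, so no other pair can land there.
  have hinj : Function.Injective fun i => (σ (i, 0)).1 := by
    intro i j hij
    have h : σ (j, 0) = σ (i, 0) ∨ σ (j, 0) = σ (i, 1) := by
      have h1 := hsnd i
      have h2 := hfst i
      simp only at hij
      rcases eq_or_ne (σ (j, 0)).2 (σ (i, 0)).2 with h3 | h3
      · exact Or.inl (Prod.ext hij.symm h3)
      · exact Or.inr (Prod.ext (hij.symm.trans h2) (by omega))
    rcases h with h | h <;> simpa using (congrArg Prod.fst (σ.injective h)).symm
  let τ : Equiv.Perm (Fin n) := Equiv.ofBijective _ (Finite.injective_iff_bijective.1 hinj)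
  let ε : Fin n → Equiv.Perm (Fin 2) := fun i => if (σ (i, 0)).2 = 0 then 1 else Equiv.swap 0 1
  -- σ flips inside the pairs (ε), then permutes the pairs (τ).
  have hσ : σ = Equiv.prodCongrLeft (fun _ => τ) * Equiv.prodCongrRight ε := by
    ext1 ⟨i, k⟩
    have h1 := hsnd i
    have h2 := hfst i
    have h3 : ε i k = (σ (i, k)).2 := by
      simp only [ε]
      split_ifs with h <;> fin_cases k <;> simp [h] <;> omega
    have h4 : τ i = (σ (i, k)).1 := by
      fin_cases k
      · rfl
      · exact h2
    simp [h3, h4]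
  -- τ acts on two copies of the index set, so its sign is squared away. Each flip's sign then
  -- cancels the matching value -1 of B.
  have hsign : Equiv.Perm.sign σ = ∏ i, Equiv.Perm.sign (ε i) := by
    rw [hσ, Equiv.Perm.sign_mul, Equiv.Perm.sign_prodCongrLeft, Equiv.Perm.sign_prodCongrRight]
    simp [Int.units_sq]
  rw [hsign]
  push_cast
  rw [← Finset.prod_mul_distrib]
  refine Finset.prod_nonneg fun i _ => ?_
  rw [hval]
  simp only [ε]
  split_ifs <;> simp

/-- A `J`-invariant positive alternating form on a complex vector space admits a unitary basis. -/
theorem exists_unitary_basis [Module ℂ V] [FiniteDimensional ℂ V] {n : ℕ}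
    (hn : Module.finrank ℂ V = n)
    (B : V → V → ℝ) (hadd : ∀ x y z, B (x + y) z = B x z + B y z)
    (hsmul : ∀ (c : ℝ) x y, B ((c : ℂ) • x) y = c * B x y)
    (hskew : ∀ x y, B x y = - B y x)
    (hinv : ∀ x y, B (Complex.I • x) (Complex.I • y) = B x y)
    (hpos : ∀ x, x ≠ 0 → 0 < B x (Complex.I • x)) :
    ∃ b : Module.Basis (Fin n) ℂ V, (∀ i j, B (b i) (b j) = 0) ∧
      ∀ i j, B (b i) (Complex.I • b j) = if i = j then 1 else 0 := by
  have hsmul' : ∀ (c : ℝ) x y, B (c • x) y = c * B x y := fun c x y => by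
    rw [← hsmul, Complex.coe_smul]
  have hII : ∀ x : V, Complex.I • Complex.I • x = -x := fun x => by
    rw [smul_smul, Complex.I_mul_I, neg_one_smul]
  have hneg : ∀ x y, B (-x) y = - B x y := fun x y => by
    simpa using hsmul (-1) x y
  have hI : ∀ x y, B (Complex.I • x) y = - B x (Complex.I • y) := fun x y => by
    rw [← hinv, hII, hneg]
  -- The Hermitian form B(x, Iy) + i B(x, y), conjugate linear in x. The real and imaginary parts of
  -- orthonormality are the two claims.
  let c : InnerProductSpace.Core ℂ V :=
    { inner := fun x y => ⟨B x (Complex.I • y), B x y⟩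
      conj_inner_symm := fun x y => by
        apply Complex.ext
        · simp only [Complex.conj_re]
          rw [hskew, hI, neg_neg]
        · simp only [Complex.conj_im]
          rw [hskew, neg_neg]
      re_inner_nonneg := fun x => by
        rcases eq_or_ne x 0 with rfl | hx
        · have := hsmul 0 0 (Complex.I • (0 : V))
          simp at this
          simp [this]
        · exact (hpos x hx).le
      add_left := fun x y z => by
        apply Complex.ext <;> simp [hadd]
      smul_left := fun x y r => by
        have hr : r • x = (r.re : ℂ) • x + Complex.I • (r.im : ℂ) • x := by
          rw [smul_smul, ← add_smul, mul_comm, Complex.re_add_im]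
        rw [hr]
        apply Complex.ext
        · simp [hadd, hsmul', hI, hII]
          rw [hskew _ (-y), hneg, hskew y]
          ring
        · simp [hadd, hsmul', hI]
      definite := fun x hx => by
        by_contra h
        exact (hpos x h).ne' (congrArg Complex.re hx) }
  let := c.toNormedAddCommGroup
  let : InnerProductSpace ℂ V := InnerProductSpace.ofCore c.toCore
  let b := (stdOrthonormalBasis ℂ V).reindex (finCongr hn)
  have hb : ∀ i j, (⟨B (b i) (Complex.I • b j), B (b i) (b j)⟩ : ℂ) = if i = j then 1 else 0 :=
    fun i j => orthonormal_iff_ite.1 b.orthonormal i j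
  refine ⟨b.toBasis, fun i j => ?_, fun i j => ?_⟩
  · have := congrArg Complex.im (hb i j)
    simp only [OrthonormalBasis.coe_toBasis]
    simp only at this
    rw [this]
    split_ifs <;> simp
  · have := congrArg Complex.re (hb i j)
    simp only [OrthonormalBasis.coe_toBasis]
    simp only at this
    rw [this]
    split_ifs <;> simp

/-- The top wedge power of a positive `J`-invariant alternating form is a positive multiple of the
standard volume form. -/
theorem wedgePower_realFrame_pos {n : ℕ} (B : CSpace n →ₗ[ℝ] CSpace n →ₗ[ℝ] ℝ)
    (halt : ∀ x, B x x = 0)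
    (hinv : ∀ x y, B (Complex.I • x) (Complex.I • y) = B x y)
    (hpos : ∀ x, x ≠ 0 → 0 < B x (Complex.I • x)) :
    0 < wedgePower n (fun u v => B u v) (realFrame n) := by
  have hskew : ∀ x y, B x y = - B y x := fun x y => by
    have := halt (x + y)
    simp only [map_add, LinearMap.add_apply, halt] at this
    linarith
  obtain ⟨b, hb, hbI⟩ := exists_unitary_basis (V := CSpace n) (n := n) (by simp)
    (fun x y => B x y) (fun x y z => by simp) (fun c x y => by
      rw [Complex.coe_smul]; simp) hskew hinv hpos
  let e : Module.Basis (Fin n × Fin 2) ℝ (CSpace n) :=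
    Complex.basisOneI.smulTower' (Pi.basisFun ℂ (Fin n))
  have he : (e : Fin n × Fin 2 → CSpace n) = realFrame n := by
    ext1 ⟨i, k⟩
    fin_cases k <;> simp [e, realFrame, Module.Basis.smulTower'_apply, ← Pi.single_smul]
  let T : CSpace n ≃ₗ[ℂ] CSpace n := (Pi.basisFun ℂ (Fin n)).equiv b (Equiv.refl _)
  have hT : ∀ i, T (Pi.single i 1) = b i := fun i => by
    simpa using (Pi.basisFun ℂ (Fin n)).equiv_apply i b (Equiv.refl _)
  have hTI : ∀ i, T (Pi.single i Complex.I) = Complex.I • b i := fun i => by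
    rw [← hT, ← map_smul, ← Pi.single_smul, smul_eq_mul, mul_one]
  let g : CSpace n →ₗ[ℝ] CSpace n := (T : CSpace n →ₗ[ℂ] CSpace n).restrictScalars ℝ
  -- The real determinant of a complex linear map is the squared modulus of the complex one.
  have hdet : 0 < LinearMap.det g := by
    rw [LinearMap.det_restrictScalars, Algebra.norm_complex_apply]
    exact Complex.normSq_pos.2 (LinearEquiv.isUnit_det' T).ne_zero
  have hp : 0 < wedgePower n (fun u v => B u v) (g ∘ realFrame n) := by
    have h0 : ∀ i, (g ∘ realFrame n) (i, 0) = b i := fun i => by simp [g, realFrame, hT]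
    have h1 : ∀ i, (g ∘ realFrame n) (i, 1) = Complex.I • b i := fun i => by
      simp [g, realFrame, hTI]
    apply wedgePower_pos_of_symplectic <;> intro i j <;> simp only [h0, h1]
    · exact hb i j
    · rw [hinv]; exact hb i j
    · exact hbI i j
    · rw [hskew, hbI]
      simp only [eq_comm]
      split_ifs <;> simp
  rw [wedgePower_eq_alternatization] at hp ⊢
  rw [← he, AlternatingMap.map_comp_basis, mul_left_comm] at hp
  rw [← he]
  exact (pos_iff_pos_of_mul_pos hp).1 hdet

end LinearAlgebra

/-! ### Holomorphic charts, uniqueness of potentials, positivity of ωⁿ. -/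

section Manifold

variable {n : ℕ} {M : Type*} [TopologicalSpace M] [ChartedSpace (CSpace n) M]

/-- A complex manifold is a smooth real manifold. -/
theorem isManifold_real [IsManifold 𝓘(ℂ, CSpace n) ω M] : IsManifold 𝓘(ℝ, CSpace n) ∞ M := by
  refine isManifold_of_contDiffOn _ _ _ fun e e' he he' => ?_
  have h := (contDiffGroupoid ω 𝓘(ℂ, CSpace n)).compatible he he'
  rw [contDiffGroupoid, mem_groupoid_of_pregroupoid] at h
  replace h := h.1
  exact (ContDiffOn.restrict_scalars ℝ h).of_le (by exact_mod_cast le_top)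

/-- The derivative of the inverse of a holomorphic chart is complex linear. -/
theorem mfderiv_symm_smul_I [IsManifold 𝓘(ℂ, CSpace n) ω M]
    {e : OpenPartialHomeomorph M (CSpace n)} (he : e ∈ atlas (CSpace n) M) {y : CSpace n}
    (hy : y ∈ e.target) (u : CSpace n) :
    mfderiv 𝓘(ℝ, CSpace n) 𝓘(ℝ, CSpace n) e.symm y (Complex.I • u : CSpace n)
      = complexStructure (mfderiv 𝓘(ℝ, CSpace n) 𝓘(ℝ, CSpace n) e.symm y u) := by
  have : IsManifold 𝓘(ℂ, CSpace n) 1 M := IsManifold.of_le (n := ω) (by simp)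
  have h := (mdifferentiableAt_atlas_symm (I := 𝓘(ℂ, CSpace n)) he hy).hasMFDerivAt
  have hR : HasMFDerivAt 𝓘(ℝ, CSpace n) 𝓘(ℝ, CSpace n) e.symm y
      ((show CSpace n →L[ℂ] CSpace n from
        mfderiv 𝓘(ℂ, CSpace n) 𝓘(ℂ, CSpace n) e.symm y).restrictScalars ℝ) :=
    ⟨h.1, h.2.restrictScalars ℝ⟩
  rw [hR.mfderiv]
  exact (show CSpace n →L[ℂ] CSpace n from
        mfderiv 𝓘(ℂ, CSpace n) 𝓘(ℂ, CSpace n) e.symm y).map_smul Complex.I u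

/-- Two smooth functions with the same differential on a connected manifold differ by a constant. -/
theorem exists_eq_add_const [ConnectedSpace M] [IsManifold 𝓘(ℝ, CSpace n) ∞ M] {f g : M → ℝ}
    (hf : ContMDiff 𝓘(ℝ, CSpace n) 𝓘(ℝ, ℝ) ∞ f) (hg : ContMDiff 𝓘(ℝ, CSpace n) 𝓘(ℝ, ℝ) ∞ g)
    (h : ∀ (x : M) (v : RealTangent n x), mfderiv 𝓘(ℝ, CSpace n) 𝓘(ℝ, ℝ) f x v
      = mfderiv 𝓘(ℝ, CSpace n) 𝓘(ℝ, ℝ) g x v) :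
    ∃ C : ℝ, ∀ x, f x = g x + C := by
  have : IsManifold 𝓘(ℝ, CSpace n) 1 M := IsManifold.of_le (n := ∞) (by norm_num)
  have key : ∀ {k : M → ℝ}, ContMDiff 𝓘(ℝ, CSpace n) 𝓘(ℝ, ℝ) ∞ k → ∀ x : M,
      ∀ y ∈ (chartAt (CSpace n) x).target,
      HasFDerivAt (k ∘ (chartAt (CSpace n) x).symm)
        ((mfderiv 𝓘(ℝ, CSpace n) 𝓘(ℝ, ℝ) k ((chartAt (CSpace n) x).symm y)).comp
        (mfderiv 𝓘(ℝ, CSpace n) 𝓘(ℝ, CSpace n) (chartAt (CSpace n) x).symm y) :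
          CSpace n →L[ℝ] ℝ) y := by
    intro k hk x y hy
    exact (HasMFDerivAt.comp y ((hk.mdifferentiable (by norm_num)) _).hasMFDerivAt
      (mdifferentiableAt_atlas_symm (chart_mem_atlas _ x) hy).hasMFDerivAt).hasFDerivAt
  have hloc : IsLocallyConstant fun x => f x - g x := by
    rw [IsLocallyConstant.iff_eventually_eq]
    intro x
    set e := chartAt (CSpace n) x with he
    have hd : ∀ y ∈ e.target, HasFDerivAt (fun z => f (e.symm z) - g (e.symm z))
        (0 : CSpace n →L[ℝ] ℝ) y := by
      intro y hy
      refine ((key hf x y hy).sub (key hg x y hy)).congr_fderiv ?_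
      exact ContinuousLinearMap.ext fun v => sub_eq_zero.2 (h _ _)
    have hxt : e x ∈ e.target := mem_chart_target _ x
    -- The chart target need not be connected; a ball inside it is convex.
    obtain ⟨r, hr, hball⟩ := Metric.isOpen_iff.1 e.open_target _ hxt
    have hev : ∀ᶠ z in 𝓝 x, z ∈ e.source ∧ e z ∈ Metric.ball (e x) r :=
      Filter.Eventually.and (e.open_source.mem_nhds (mem_chart_source _ x))
        ((e.continuousAt (mem_chart_source _ x)).eventually (Metric.ball_mem_nhds _ hr))
    filter_upwards [hev] with z hz
    have := (convex_ball (e x) r).is_const_of_fderivWithin_eq_zero (𝕜 := ℝ)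
      (f := fun z => f (e.symm z) - g (e.symm z))
      (fun y hy => (hd y (hball hy)).differentiableAt.differentiableWithinAt)
      (fun y hy => ((hd y (hball hy)).hasFDerivWithinAt.fderivWithin
        (Metric.isOpen_ball.uniqueDiffWithinAt hy)))
      hz.2 (Metric.mem_ball_self hr)
    simpa [e.left_inv hz.1, e.left_inv (mem_chart_source _ x)] using this
  obtain ⟨x₀⟩ := (inferInstance : Nonempty M)
  refine ⟨f x₀ - g x₀, fun x => ?_⟩
  have : f x - g x = f x₀ - g x₀ :=
    hloc.apply_eq_of_isPreconnected isPreconnected_univ (mem_univ x) (mem_univ x₀)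
  linarith

namespace KahlerForm

theorem IsHamiltonian.exists_eq_add_const [ConnectedSpace M] [IsManifold 𝓘(ℝ, CSpace n) ∞ M]
    {ωX : KahlerForm n M} {ξ : ∀ x : M, RealTangent n x} {f g : M → ℝ}
    (hf : ωX.IsHamiltonian ξ f) (hg : ωX.IsHamiltonian ξ g) : ∃ C : ℝ, ∀ x, f x = g x + C :=
  _root_.exists_eq_add_const hf.smooth hg.smooth fun x v => by rw [hf.d_eq, hg.d_eq]

/-- The derivative of the inverse chart is injective and complex linear, so the pulled-back form is
still J-invariant and positive. -/
theorem powDensity_pos [IsManifold 𝓘(ℂ, CSpace n) ω M] (ωX : KahlerForm n M)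
    {e : OpenPartialHomeomorph M (CSpace n)} (he : e ∈ atlas (CSpace n) M) {y : CSpace n}
    (hy : y ∈ e.target) : 0 < ωX.powDensity e y := by
  have : IsManifold 𝓘(ℝ, CSpace n) ∞ M := isManifold_real
  have : IsManifold 𝓘(ℝ, CSpace n) 1 M := IsManifold.of_le (n := ∞) (by norm_num)
  let D : CSpace n →L[ℝ] CSpace n := mfderiv 𝓘(ℝ, CSpace n) 𝓘(ℝ, CSpace n) e.symm y
  have hinj : Function.Injective D :=
    (mdifferentiable_of_mem_atlas (I := 𝓘(ℝ, CSpace n)) he).symm.mfderiv_injective hy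
  let F : CSpace n →L[ℝ] CSpace n →L[ℝ] ℝ := ωX.form (e.symm y)
  let B : CSpace n →ₗ[ℝ] CSpace n →ₗ[ℝ] ℝ :=
    LinearMap.mk₂ ℝ (fun u v => F (D u) (D v)) (by simp) (by simp) (by simp) (by simp)
  have hD : ∀ u, D (Complex.I • u) = Complex.I • D u := fun u => mfderiv_symm_smul_I he hy u
  refine wedgePower_realFrame_pos B (fun x => ωX.alternating _ _) (fun u v => ?_) (fun u hu => ?_)
  · change F (D (Complex.I • u)) (D (Complex.I • v)) = F (D u) (D v)
    rw [hD, hD]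
    exact ωX.invariant (e.symm y) (D u) (D v)
  · change 0 < F (D u) (D (Complex.I • u))
    rw [hD]
    exact ωX.positive (e.symm y) (D u) fun h => hu (hinj (h.trans D.map_zero.symm))

theorem continuousOn_powDensity (ωX : KahlerForm n M) {e : OpenPartialHomeomorph M (CSpace n)}
    (he : e ∈ atlas (CSpace n) M) : ContinuousOn (ωX.powDensity e) e.target :=
  continuousOn_const.mul (continuousOn_finsetSum _ fun _ _ => continuousOn_const.mul
    (continuousOn_finsetProd _ fun _ _ => (ωX.smooth e he _ _).continuousOn))

end KahlerForm

end Manifold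

/-! ### Finiteness and nonvanishing of the measure ωⁿ. -/

namespace KahlerForm

section Cutoff

variable {n : ℕ} {M : Type*} [TopologicalSpace M] [T2Space M] [CompactSpace M]
  [ChartedSpace (CSpace n) M]

/-- The density in the chart at `x` of the part of `ωⁿ` cut off by the partition of unity. -/
noncomputable def cutDensity (ωX : KahlerForm n M) (x : M) (y : CSpace n) : ℝ :=
  chartPartition n M x ((chartAt (CSpace n) x).symm y) * ωX.powDensity (chartAt (CSpace n) x) y

theorem continuousOn_cutDensity (ωX : KahlerForm n M) (x : M) :
    ContinuousOn (ωX.cutDensity x) (chartAt (CSpace n) x).target :=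
  ((chartPartition n M x).continuous.comp_continuousOn
    (chartAt (CSpace n) x).continuousOn_symm).mul
    (ωX.continuousOn_powDensity (chart_mem_atlas _ x))

/-- The density may be unbounded on the whole chart target, but the cutoff confines it to the
compact image of its support, where it is continuous. -/
theorem lintegral_cutDensity_lt_top (ωX : KahlerForm n M) (x : M) :
    ∫⁻ y in (chartAt (CSpace n) x).target, ENNReal.ofReal (ωX.cutDensity x y) < ⊤ := by
  set e := chartAt (CSpace n) x
  let K := e '' tsupport (chartPartition n M x)
  have hsub : tsupport (chartPartition n M x) ⊆ e.source :=
    (exists_chartPartition n M).choose_spec x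
  have hK : IsCompact K := (isClosed_tsupport _).isCompact.image_of_continuousOn
    (e.continuousOn.mono hsub)
  have hKt : K ⊆ e.target := by
    rintro _ ⟨z, hz, rfl⟩
    exact e.map_source (hsub hz)
  have hzero : ∀ y ∈ e.target, y ∉ K → ENNReal.ofReal (ωX.cutDensity x y) = 0 := by
    intro y hy hyK
    have : chartPartition n M x (e.symm y) = 0 := by
      by_contra h
      exact hyK ⟨e.symm y, subset_tsupport _ h, e.right_inv hy⟩
    simp [cutDensity, e, this]
  have hint : IntegrableOn (ωX.cutDensity x) K :=
    ((ωX.continuousOn_cutDensity x).mono hKt).integrableOn_compact hK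
  calc ∫⁻ y in e.target, ENNReal.ofReal (ωX.cutDensity x y)
      = ∫⁻ y in K, ENNReal.ofReal (ωX.cutDensity x y) := by
        rw [← lintegral_indicator e.open_target.measurableSet,
          ← lintegral_indicator hK.measurableSet]
        congr 1
        ext y
        by_cases hyK : y ∈ K
        · simp [hyK, hKt hyK]
        · by_cases hy : y ∈ e.target
          · simp [hyK, hy, hzero y hy hyK]
          · simp [hyK, hy]
    _ ≤ ∫⁻ y in K, ‖ωX.cutDensity x y‖ₑ := lintegral_mono fun y => Real.ofReal_le_enorm _
    _ < ⊤ := hint.2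

end Cutoff

section Integral

variable {n : ℕ} {M : Type*} [TopologicalSpace M] [T2Space M] [CompactSpace M]
  [ChartedSpace (CSpace n) M] [MeasurableSpace M]

theorem intPow_const_mul (ωX : KahlerForm n M) (c : ℝ) (f : M → ℝ) :
    ωX.intPow (fun x => c * f x) = c * ωX.intPow f :=
  integral_const_mul c f

variable [BorelSpace M]

theorem powMeasure_univ (ωX : KahlerForm n M) :
    ωX.powMeasure univ = ∑' x : M,
      ∫⁻ y in (chartAt (CSpace n) x).target, ENNReal.ofReal (ωX.cutDensity x y) := by
  rw [powMeasure, Measure.sum_apply _ MeasurableSet.univ]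
  congr 1
  ext x
  rw [Measure.map_apply_of_aemeasurable _ MeasurableSet.univ, preimage_univ,
    withDensity_apply _ MeasurableSet.univ, Measure.restrict_univ]
  · rfl
  -- The inverse chart is continuous only on the target, hence only a.e. measurable for the
  -- restricted measure.
  · exact ((chartAt (CSpace n) x).continuousOn_symm.aemeasurable
      (chartAt (CSpace n) x).open_target.measurableSet).mono_ac (withDensity_absolutelyContinuous _ _)

/-- Local finiteness and compactness leave finitely many nonzero cutoffs in the sum over all points
of `M`. -/
instance isFiniteMeasure_powMeasure (ωX : KahlerForm n M) : IsFiniteMeasure ωX.powMeasure where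
  measure_univ_lt_top := by
    have hfin : {x : M | (Function.support (chartPartition n M x)).Nonempty}.Finite :=
      (chartPartition n M).locallyFinite.finite_nonempty_of_compact
    rw [powMeasure_univ, tsum_eq_sum (s := hfin.toFinset)]
    · exact ENNReal.sum_lt_top.2 fun x _ => ωX.lintegral_cutDensity_lt_top x
    · intro x hx
      have h : ∀ z, chartPartition n M x z = 0 := fun z => by
        by_contra hz
        exact hx (hfin.mem_toFinset.2 ⟨z, hz⟩)
      simp [cutDensity, h]

/-- Some cutoff is positive at a given point, so its density is positive on a nonempty open set,
which has positive Lebesgue measure. -/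
theorem powMeasure_univ_ne_zero [Nonempty M] [IsManifold 𝓘(ℂ, CSpace n) ω M]
    (ωX : KahlerForm n M) : ωX.powMeasure univ ≠ 0 := by
  obtain ⟨p⟩ := ‹Nonempty M›
  obtain ⟨x, hx⟩ := (chartPartition n M).exists_pos (mem_univ p)
  have hsub : tsupport (chartPartition n M x) ⊆ (chartAt (CSpace n) x).source :=
    (exists_chartPartition n M).choose_spec x
  have hp : p ∈ (chartAt (CSpace n) x).source := hsub (subset_tsupport _ hx.ne')
  set e := chartAt (CSpace n) x with he
  rw [powMeasure_univ, ne_eq, ENNReal.tsum_eq_zero]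
  intro h0
  have hmeas : AEMeasurable (fun y => ENNReal.ofReal (ωX.cutDensity x y))
      (volume.restrict e.target) :=
    ((ωX.continuousOn_cutDensity x).aemeasurable e.open_target.measurableSet).ennreal_ofReal
  have hae := (lintegral_eq_zero_iff' hmeas).1 (h0 x)
  rw [Filter.EventuallyEq, ae_restrict_iff' e.open_target.measurableSet] at hae
  have hopen : IsOpen (e.target ∩ ωX.cutDensity x ⁻¹' Ioi 0) :=
    (ωX.continuousOn_cutDensity x).isOpen_inter_preimage e.open_target isOpen_Ioi
  have hne : (e.target ∩ ωX.cutDensity x ⁻¹' Ioi 0).Nonempty := by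
    refine ⟨e p, e.map_source hp, ?_⟩
    refine mul_pos ?_ (ωX.powDensity_pos (chart_mem_atlas _ x) (e.map_source hp))
    rw [← he, e.left_inv hp]
    exact hx
  refine hopen.measure_ne_zero volume hne (measure_mono_null ?_ (ae_iff.1 hae))
  rintro y ⟨hy, hpos⟩
  simpa [hy] using hpos

theorem integrable_powMeasure (ωX : KahlerForm n M) {f : M → ℝ} (hf : Continuous f) :
    Integrable f ωX.powMeasure := by
  obtain ⟨C, hC⟩ := isCompact_univ.exists_bound_of_continuousOn hf.continuousOn
  exact Integrable.of_bound hf.measurable.aestronglyMeasurable C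
    (Filter.Eventually.of_forall fun x => hC x (mem_univ x))

theorem intPow_one_pos [Nonempty M] [IsManifold 𝓘(ℂ, CSpace n) ω M] (ωX : KahlerForm n M) :
    0 < ωX.intPow fun _ => 1 := by
  simp only [intPow, integral_const, smul_eq_mul, mul_one]
  exact ENNReal.toReal_pos ωX.powMeasure_univ_ne_zero (measure_ne_top _ _)

theorem intPow_add (ωX : KahlerForm n M) {f g : M → ℝ} (hf : Continuous f) (hg : Continuous g) :
    ωX.intPow (fun x => f x + g x) = ωX.intPow f + ωX.intPow g :=
  integral_add (ωX.integrable_powMeasure hf) (ωX.integrable_powMeasure hg)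

theorem intPow_sub (ωX : KahlerForm n M) {f g : M → ℝ} (hf : Continuous f) (hg : Continuous g) :
    ωX.intPow (fun x => f x - g x) = ωX.intPow f - ωX.intPow g :=
  integral_sub (ωX.integrable_powMeasure hf) (ωX.integrable_powMeasure hg)

end Integral

end KahlerForm

/-! ### The Futaki invariant as a pairing. -/

theorem mainTheorem4 {n : ℕ} {M : Type*} [TopologicalSpace M] [T2Space M] [CompactSpace M]
    [ConnectedSpace M] [ChartedSpace (CSpace n) M] [IsManifold 𝓘(ℂ, CSpace n) ω M]
    [MeasurableSpace M] [BorelSpace M]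
    (ωX : KahlerForm n M)
    -- the normalized Ricci potential
    (φ : M → ℝ) (hφ : ωX.IsRicciPotential φ)
    (hφ_norm : (1 / ωX.vol) * ωX.intVol (fun x => Real.exp (φ x) - 1) = 0)
    (ξ η : ∀ x : M, RealTangent n x) (hξ : ωX.IsAut ξ) (hη : ωX.IsAut η)
    -- the Hamiltonians of `η` normalized by `∫ θ ωⁿ/n! = 0` and by `∫ θ e^φ ωⁿ/n! = 0`
    (θη θη' : M → ℝ) (hθη : ωX.IsHamiltonian η θη) (hθη' : ωX.IsHamiltonian η θη')
    (hθη_norm : ωX.intVol θη = 0)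
    (hθη'_norm : ωX.intVol (fun x => θη' x * Real.exp (φ x)) = 0)
    -- the Hamiltonians of `ξ` normalized by `∫ (e^θ - 1) ωⁿ/n! = 0` and by `∫ θ e^φ ωⁿ/n! = 0`
    (θξ_hat θξ' : M → ℝ) (hθξ_hat : ωX.IsHamiltonian ξ θξ_hat) (hθξ' : ωX.IsHamiltonian ξ θξ')
    (hθξ_hat_norm : ωX.intVol (fun x => Real.exp (θξ_hat x) - 1) = 0)
    (hθξ'_norm : ωX.intVol (fun x => θξ' x * Real.exp (φ x)) = 0) :
    ωX.intPow (fun x => θη' x * Real.exp (θξ' x)) / ωX.intPow (fun x => Real.exp (θξ' x))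
        = ωX.pairing (ωX.dDHat θξ_hat - ωX.momentMap φ) θη
    ∧ ∃ C : ℝ,
        (∀ x, θξ' x = θξ_hat x + C)
        ∧ Real.exp C
          = ωX.intPow (fun x => Real.exp (θξ' x)) / ωX.intPow (fun x => Real.exp (θξ_hat x))
        ∧ (1 / ωX.vol) * ωX.intVol (fun x => θη' x * Real.exp (θξ' x))
          = Real.exp C * ωX.pairing (ωX.dDHat θξ_hat - ωX.momentMap φ) θη := by
  have : IsManifold 𝓘(ℝ, CSpace n) ∞ M := isManifold_real
  obtain ⟨c, hc⟩ := hθη'.exists_eq_add_const hθη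
  obtain ⟨C, hC⟩ := hθξ'.exists_eq_add_const hθξ_hat
  have hφc : Continuous φ := hφ.smooth.continuous
  have hθc : Continuous θη := hθη.smooth.continuous
  have hξc : Continuous θξ_hat := hθξ_hat.smooth.continuous
  have hN : (n.factorial : ℝ) ≠ 0 := by exact_mod_cast n.factorial_ne_zero
  have hW : ωX.intPow (fun _ => 1) ≠ 0 := ωX.intPow_one_pos.ne'
  have hV : ωX.vol ≠ 0 := div_ne_zero hW hN
  have hexp : ∀ {u : M → ℝ}, Continuous u → ωX.intVol (fun x => Real.exp (u x) - 1) = 0 →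
      ωX.intPow (fun x => Real.exp (u x)) = ωX.intPow fun _ => 1 := fun {u} hu h => by
    rw [KahlerForm.intVol, ωX.intPow_sub hu.rexp continuous_const, div_eq_zero_iff] at h
    exact sub_eq_zero.1 (h.resolve_right hN)
  have hE := hexp hξc hθξ_hat_norm
  have hF := hexp hφc ((mul_eq_zero.1 hφ_norm).resolve_left (one_div_ne_zero hV))
  have hmul : ∀ {u : M → ℝ}, Continuous u →
      ωX.intPow (fun x => Real.exp (u x)) = ωX.intPow (fun _ => 1) →
      ωX.intPow (fun x => θη' x * Real.exp (u x))
        = ωX.intPow (fun x => θη x * Real.exp (u x)) + c * ωX.intPow fun _ => 1 :=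
    fun {u} hu h => by
      rw [← h, ← ωX.intPow_const_mul, ← ωX.intPow_add (by fun_prop) (by fun_prop)]
      simp only [hc, add_mul]
  -- The normalization of θ̃_η against e^φ determines c.
  have hF' : ωX.intPow (fun x => θη x * Real.exp (φ x)) = -(c * ωX.intPow fun _ => 1) := by
    rw [KahlerForm.intVol, hmul hφc hF, div_eq_zero_iff] at hθη'_norm
    exact eq_neg_of_add_eq_zero_left (hθη'_norm.resolve_right hN)
  -- The two -1 terms cancel, and `hF'` turns -∫θ_η e^φ into the cW that changes θ_η to θ̃_η.
  have hpair : ωX.pairing (ωX.dDHat θξ_hat - ωX.momentMap φ) θη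
      = ωX.intPow (fun x => θη' x * Real.exp (θξ_hat x)) / ωX.intPow fun _ => 1 := by
    have h : (fun x => (ωX.dDHat θξ_hat - ωX.momentMap φ) x * θη x) = fun x =>
        1 / ωX.vol * (θη x * Real.exp (θξ_hat x) - θη x * Real.exp (φ x)) := by
      ext x
      simp only [Pi.sub_apply, KahlerForm.dDHat, KahlerForm.momentMap]
      ring
    rw [KahlerForm.pairing, KahlerForm.intVol, h, ωX.intPow_const_mul, ωX.intPow_sub (by fun_prop) (by fun_prop), hF',
      sub_neg_eq_add, hmul hξc hE, KahlerForm.vol, KahlerForm.intVol]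
    field_simp
  have hshift : ωX.intPow (fun x => Real.exp (θξ' x))
      = Real.exp C * ωX.intPow fun _ => 1 := by
    rw [← hE, ← ωX.intPow_const_mul]
    simp only [hC, Real.exp_add, mul_comm]
  have hshift' : ωX.intPow (fun x => θη' x * Real.exp (θξ' x))
      = Real.exp C * ωX.intPow fun x => θη' x * Real.exp (θξ_hat x) := by
    rw [← ωX.intPow_const_mul]
    simp only [hC, Real.exp_add, mul_comm, mul_left_comm]
  have hC0 := (Real.exp_pos C).ne'
  refine ⟨?_, C, hC, ?_, ?_⟩
  · rw [hshift, hshift', hpair, mul_div_mul_left _ _ hC0]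
  · rw [hshift, hE, mul_div_cancel_right₀ _ hW]
  · rw [hpair, KahlerForm.intVol, hshift', KahlerForm.vol, KahlerForm.intVol]
    field_simp
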